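/- Simple types are generated from one ground type $\mathrm{bool}$ by $\sigma\to\tau$. Let $\mathcal S$ be the full type hierarchy over the set $\{t\!t,f\!\!f\}$, so $\mathcal S_{\sigma\to\tau}$ is the set of all functions $\mathcal S_\sigma\to\mathcal S_\tau$. Let $\mathcal C$ and $\mathcal L$ be the hierarchies of monotone functions (ordered pointwise at higher types) over the partial orders $\{\bot<t\!t,f\!\!f\}$ and $\{\bot<t\!t,f\!\!f<\top\}$ respectively. Let $\Lambda^S$ be the simply typed $\lambda$-calculus with constants $\mathtt{true},\mathtt{false}:\mathrm{bool}$ and $\mathtt{if}:\mathrm{bool}\to\mathrm{bool}\to\mathrm{bool}\to\mathrm{bool}$, and $\delta$-rules $\mathtt{if}\ \mathtt{true}\ M\ N\to M$, $\mathtt{if}\ \mathtt{false}\ M\ N\to N$. Let $\Lambda^C$ be its extension by $\Omega:\mathrm{bool}$ and $\mathtt{por}:\mathrm{bool}\to\mathrm{bool}\to\mathrm{bool}$, with the further rules $\mathtt{por}\ \mathtt{true}\ M\to\mathtt{true}$, $\mathtt{por}\ M\ \mathtt{true}\to\mathtt{true}$, $\mathtt{por}\ \mathtt{false}\ \mathtt{false}\to\mathtt{false}$.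 Terms are interpreted in these hierarchies as usual, with $\mathtt{true}\mapsto t\!t$, $\mathtt{false}\mapsto f\!\!f$, $\Omega\mapsto\bot$. The function $\mathtt{if}\,d\,e\,f$ is $e$ for $d=t\!t$, $f$ for $d=f\!\!f$, $\bot$ for $d=\bot$, and (in $\mathcal L$) $\top$ for $d=\top$. In both $\mathcal C$ and $\mathcal L$, $\mathtt{por}\,d\,e$ is the least upper bound of the set that contains $t\!t$ if and only if $d\ge t\!t$ or $e\ge t\!t$, contains $f\!\!f$ if and only if $d\ge f\!\!f$ and $e\ge f\!\!f$, and has no other element. These interpretations validate the $\delta$-rules, so $\mathcal S$ and $\mathcal C$ are models of $\Lambda^S$, and $\mathcal C$ and $\mathcal L$ are models of $\Lambda^C$. For a model $\mathcal M$ of a calculus $\Lambda$, let $\mathrm{Th}^{\Lambda}(\mathcal M)$ be the set of equations $P=Q$ between closed $\Lambda$-terms of the same type that have the same interpretation in $\mathcal M$. Then $$\mathrm{Th}^{\Lambda^S}(\mathcal C)\subsetneq\mathrm{Th}^{\Lambda^S}(\mathcal S)\qquad\text{and}\qquad \mathrm{Th}^{\Lambda^C}(\mathcal L)\subsetneq\mathrm{Th}^{\Lambda^C}(\mathcal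 C).$$ Moreover, the equation $\lambda x{:}\mathrm{bool}.\,\mathtt{true}=\lambda x{:}\mathrm{bool}.\,\mathtt{if}\ x\ \mathtt{true}\ \mathtt{true}$ belongs to $\mathrm{Th}^{\Lambda^S}(\mathcal S)$ but not to $\mathrm{Th}^{\Lambda^S}(\mathcal C)$, and $\lambda x{:}\mathrm{bool}.\,\Omega=\lambda x{:}\mathrm{bool}.\,\mathtt{if}\ x\ \Omega\ \Omega$ belongs to $\mathrm{Th}^{\Lambda^C}(\mathcal C)$ but not to $\mathrm{Th}^{\Lambda^C}(\mathcal L)$. -/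

import Mathlib

namespace ExtCollapse

/-- Simple types over the single ground type `bool`. -/
inductive Ty : Type
  | bool : Ty
  | arrow : Ty → Ty → Ty

/-- Typed variables (de Bruijn indices) in a context. -/
inductive Var : List Ty → Ty → Type
  | zero {Γ : List Ty} {σ : Ty} : Var (σ :: Γ) σ
  | succ {Γ : List Ty} {σ τ : Ty} : Var Γ σ → Var (τ :: Γ) σ

/-- Simply typed terms over a family `Const` of typed constants, in a context; being in de Bruijn
form, they are terms up to renaming of bound variables. -/
inductive Term (Const : Ty → Type) : List Ty → Ty → Type
  | var {Γ : List Ty} {σ : Ty} : Var Γ σ → Term Const Γ σ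
  | const {Γ : List Ty} {σ : Ty} : Const σ → Term Const Γ σ
  | app {Γ : List Ty} {σ τ : Ty} :
      Term Const Γ (Ty.arrow σ τ) → Term Const Γ σ → Term Const Γ τ
  | lam {Γ : List Ty} {σ τ : Ty} : Term Const (σ :: Γ) τ → Term Const Γ (Ty.arrow σ τ)

/-- An applied lambda-calculus: typed constants and delta-rules. -/
structure Calculus where
  Const : Ty → Type
  Delta : ∀ {Γ : List Ty} {σ : Ty}, Term Const Γ σ → Term Const Γ σ → Prop

/-- The terms of a calculus with free variables in a context. -/
abbrev Calculus.Tm (Λ : Calculus) (Γ : List Ty) (σ : Ty) : Type := Term Λ.Const Γ σ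

/-- The closed terms of a calculus. -/
abbrev Calculus.Closed (Λ : Calculus) (σ : Ty) : Type := Λ.Tm [] σ

/-- A type frame: by `ext`, the elements of type `σ → τ` are (identified with) functions. -/
structure TypeFrame where
  carrier : Ty → Type
  app : ∀ {σ τ : Ty}, carrier (Ty.arrow σ τ) → carrier σ → carrier τ
  ext : ∀ {σ τ : Ty} (f g : carrier (Ty.arrow σ τ)), (∀ x, app f x = app g x) → f = g

/-- Environments over a context. -/
abbrev Env (D : Ty → Type) (Γ : List Ty) : Type := ∀ σ : Ty, Var Γ σ → D σ

/-- The environment without variables. -/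
def Env.nil {D : Ty → Type} : Env D [] := fun _ v => nomatch v

/-- The extension of an environment by a value of the newest variable. -/
def Env.cons {D : Ty → Type} {Γ : List Ty} {τ : Ty} (ρ : Env D Γ) (d : D τ) : Env D (τ :: Γ)
  | _, Var.zero => d
  | _, Var.succ v => ρ _ v

/-- A model of a calculus. The type frame and the interpretation of constants determine `interp`,
by the four equations and `TypeFrame.ext`; its existence says that the functions
denoted by abstractions belong to the frame. -/
structure Model (Λ : Calculus) where
  frame : TypeFrame
  constInterp : ∀ {σ : Ty}, Λ.Const σ → frame.carrier σ
  interp : ∀ {Γ : List Ty} {σ : Ty}, Λ.Tm Γ σ → Env frame.carrier Γ → frame.carrier σ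
  interp_var : ∀ {Γ : List Ty} {σ : Ty} (v : Var Γ σ) (ρ : Env frame.carrier Γ),
    interp (Term.var v) ρ = ρ σ v
  interp_const : ∀ {Γ : List Ty} {σ : Ty} (c : Λ.Const σ) (ρ : Env frame.carrier Γ),
    interp (Term.const c) ρ = constInterp c
  interp_app : ∀ {Γ : List Ty} {σ τ : Ty} (P : Λ.Tm Γ (Ty.arrow σ τ)) (Q : Λ.Tm Γ σ)
    (ρ : Env frame.carrier Γ),
    interp (Term.app P Q) ρ = frame.app (interp P ρ) (interp Q ρ)
  interp_lam : ∀ {Γ : List Ty} {σ τ : Ty} (P : Λ.Tm (σ :: Γ) τ) (ρ : Env frame.carrier Γ)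
    (d : frame.carrier σ), frame.app (interp (Term.lam P) ρ) d = interp P (ρ.cons d)
  sound : ∀ {Γ : List Ty} {σ : Ty} (P Q : Λ.Tm Γ σ), Λ.Delta P Q →
    ∀ ρ : Env frame.carrier Γ, interp P ρ = interp Q ρ

/-- The interpretation of closed terms. -/
def Model.eval {Λ : Calculus} (M : Model Λ) {σ : Ty} (P : Λ.Closed σ) : M.frame.carrier σ :=
  M.interp P Env.nil

/-- Equations between closed terms of the same type. -/
abbrev Equation (Λ : Calculus) : Type := Σ σ : Ty, Λ.Closed σ × Λ.Closed σ

/-- The equation `P = Q`. -/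
def Equation.mk {Λ : Calculus} {σ : Ty} (P Q : Λ.Closed σ) : Equation Λ := ⟨σ, P, Q⟩

/-- The theory of a model. -/
def Th {Λ : Calculus} (M : Model Λ) : Set (Equation Λ) :=
  {e | M.eval e.2.1 = M.eval e.2.2}

/-! ### The calculi -/

/-- The type `bool → bool → bool`. -/
abbrev Ty.bool2 : Ty := Ty.arrow Ty.bool (Ty.arrow Ty.bool Ty.bool)

/-- The type `bool → bool → bool → bool`. -/
abbrev Ty.bool3 : Ty := Ty.arrow Ty.bool Ty.bool2

/-- Constants of the basic boolean calculus. -/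
inductive ConstS : Ty → Type
  | true : ConstS Ty.bool
  | false : ConstS Ty.bool
  | cond : ConstS Ty.bool3

/-- Constants of the calculus with non-termination and parallel-or. -/
inductive ConstC : Ty → Type
  | ofS {σ : Ty} : ConstS σ → ConstC σ
  | omega : ConstC Ty.bool
  | por : ConstC Ty.bool2

/-- The term `c P Q R`. -/
abbrev Term.app3 {K : Ty → Type} {Γ : List Ty} (c : K Ty.bool3) (P Q R : Term K Γ Ty.bool) :
    Term K Γ Ty.bool :=
  Term.app (Term.app (Term.app (Term.const c) P) Q) R

/-- The term `c P Q`. -/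
abbrev Term.app2 {K : Ty → Type} {Γ : List Ty} (c : K Ty.bool2) (P Q : Term K Γ Ty.bool) :
    Term K Γ Ty.bool :=
  Term.app (Term.app (Term.const c) P) Q

/-- Delta-rules of the basic boolean calculus. -/
inductive DeltaS : ∀ {Γ : List Ty} {σ : Ty}, Term ConstS Γ σ → Term ConstS Γ σ → Prop
  | cond_true {Γ : List Ty} (M N : Term ConstS Γ Ty.bool) :
      DeltaS (Term.app3 ConstS.cond (Term.const ConstS.true) M N) M
  | cond_false {Γ : List Ty} (M N : Term ConstS Γ Ty.bool) :
      DeltaS (Term.app3 ConstS.cond (Term.const ConstS.false) M N) N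

/-- Delta-rules of the calculus with non-termination and parallel-or (`Ω` has none). -/
inductive DeltaC : ∀ {Γ : List Ty} {σ : Ty}, Term ConstC Γ σ → Term ConstC Γ σ → Prop
  | cond_true {Γ : List Ty} (M N : Term ConstC Γ Ty.bool) :
      DeltaC (Term.app3 (ConstC.ofS ConstS.cond) (Term.const (ConstC.ofS ConstS.true)) M N) M
  | cond_false {Γ : List Ty} (M N : Term ConstC Γ Ty.bool) :
      DeltaC (Term.app3 (ConstC.ofS ConstS.cond) (Term.const (ConstC.ofS ConstS.false)) M N) N
  | por_true_left {Γ : List Ty} (M : Term ConstC Γ Ty.bool) :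
      DeltaC (Term.app2 ConstC.por (Term.const (ConstC.ofS ConstS.true)) M)
        (Term.const (ConstC.ofS ConstS.true))
  | por_true_right {Γ : List Ty} (M : Term ConstC Γ Ty.bool) :
      DeltaC (Term.app2 ConstC.por M (Term.const (ConstC.ofS ConstS.true)))
        (Term.const (ConstC.ofS ConstS.true))
  | por_false {Γ : List Ty} :
      DeltaC (Γ := Γ) (Term.app2 ConstC.por (Term.const (ConstC.ofS ConstS.false))
        (Term.const (ConstC.ofS ConstS.false))) (Term.const (ConstC.ofS ConstS.false))

/-- The basic boolean calculus. -/
def LambdaS : Calculus := ⟨ConstS, DeltaS⟩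

/-- Its extension by `Ω` and parallel-or. -/
def LambdaC : Calculus := ⟨ConstC, DeltaC⟩

/-! ### The full type hierarchy over the booleans -/

/-- All functions at higher types. -/
def FullObj : Ty → Type
  | Ty.bool => Bool
  | Ty.arrow σ τ => FullObj σ → FullObj τ

/-- The type frame `S`. -/
def frameS : TypeFrame where
  carrier := FullObj
  app f x := f x
  ext _ _ h := funext h

/-- Constants of the basic boolean calculus in `S`. -/
def constS : ∀ {σ : Ty}, ConstS σ → FullObj σ
  | _, ConstS.true => Bool.true
  | _, ConstS.false => Bool.false
  | _, ConstS.cond => fun (d e f : Bool) => match d with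
    | Bool.true => e
    | Bool.false => f

/-- Interpretation of terms in `S`. -/
def fullInterp : ∀ {Γ : List Ty} {σ : Ty}, Term ConstS Γ σ → Env FullObj Γ → FullObj σ
  | _, _, Term.var v, ρ => ρ _ v
  | _, _, Term.const c, _ => constS c
  | _, _, Term.app P Q, ρ => (fullInterp P ρ) (fullInterp Q ρ)
  | _, _, Term.lam P, ρ => fun d => fullInterp P (ρ.cons d)

/-- `S` as a model of the basic boolean calculus. -/
def modelS : Model LambdaS where
  frame := frameS
  constInterp := constS
  interp := fullInterp
  interp_var _ _ := rfl
  interp_const _ _ := rfl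
  interp_app _ _ _ := rfl
  interp_lam _ _ _ := rfl
  sound := by
    intro Γ σ P Q h ρ
    cases h <;> rfl

/-! ### Hierarchies of monotone functions -/

/-- Monotone functions, ordered pointwise, at higher types. -/
def MonoObj (D : PartOrd.{0}) : Ty → PartOrd.{0}
  | Ty.bool => D
  | Ty.arrow σ τ => PartOrd.of (MonoObj D σ →o MonoObj D τ)

/-- The underlying family of sets. -/
abbrev MonoCar (D : PartOrd.{0}) (σ : Ty) : Type := MonoObj D σ

/-- The type frame of monotone functions over the partial order `D`. -/
def monoFrame (D : PartOrd.{0}) : TypeFrame where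
  carrier := MonoCar D
  app {σ τ} (f : MonoObj D σ →o MonoObj D τ) x := f x
  ext {σ τ} (f g : MonoObj D σ →o MonoObj D τ) h := OrderHom.ext f g (funext h)

theorem Env.cons_le_cons {D : PartOrd.{0}} {Γ : List Ty} {τ : Ty} {ρ ρ' : Env (MonoCar D) Γ}
    {d d' : MonoCar D τ} (hρ : ρ ≤ ρ') (hd : d ≤ d') : ρ.cons d ≤ ρ'.cons d' := by
  intro σ v
  cases v with
  | zero => exact hd
  | succ v => exact hρ _ v

/-- Interpretation of terms in a monotone hierarchy, as a monotone function of the environment. -/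
def monoInterp (D : PartOrd.{0}) {K : Ty → Type} (C : ∀ {σ : Ty}, K σ → MonoCar D σ) :
    ∀ {Γ : List Ty} {σ : Ty}, Term K Γ σ → (Env (MonoCar D) Γ →o MonoCar D σ)
  | _, _, Term.var v => ⟨fun ρ => ρ _ v, fun _ _ h => h _ v⟩
  | _, _, Term.const c => ⟨fun _ => C c, fun _ _ _ => le_rfl⟩
  | _, _, @Term.app _ _ σ τ P Q =>
      ⟨fun ρ => (show MonoObj D σ →o MonoObj D τ from monoInterp D C P ρ) (monoInterp D C Q ρ),
        fun _ ρ' h =>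
          le_trans ((monoInterp D C P).monotone h _)
            ((show MonoObj D σ →o MonoObj D τ from monoInterp D C P ρ').monotone
              ((monoInterp D C Q).monotone h))⟩
  | _, _, @Term.lam _ _ σ τ P =>
      ⟨fun ρ => (show MonoObj D σ →o MonoObj D τ from
          ⟨fun d => monoInterp D C P (ρ.cons d),
            fun _ _ h => (monoInterp D C P).monotone (Env.cons_le_cons le_rfl h)⟩),
        fun _ _ h d => (monoInterp D C P).monotone (Env.cons_le_cons h (le_refl d))⟩

/-- A monotone hierarchy with a sound interpretation of the constants is a model. -/
def monoModel (Λ : Calculus) (D : PartOrd.{0}) (C : ∀ {σ : Ty}, Λ.Const σ → MonoCar D σ)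
    (hsound : ∀ {Γ : List Ty} {σ : Ty} (P Q : Λ.Tm Γ σ), Λ.Delta P Q →
      ∀ ρ : Env (MonoCar D) Γ, monoInterp D C P ρ = monoInterp D C Q ρ) : Model Λ where
  frame := monoFrame D
  constInterp := C
  interp P ρ := monoInterp D C P ρ
  interp_var _ _ := rfl
  interp_const _ _ := rfl
  interp_app _ _ _ := rfl
  interp_lam _ _ _ := rfl
  sound := hsound

/-- A binary monotone operation as an element of the hierarchy. -/
def mono2 (D : PartOrd.{0}) (f : D → D → D)
    (hf : ∀ a a' b b' : D, a ≤ a' → b ≤ b' → f a b ≤ f a' b') : MonoCar D Ty.bool2 :=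
  show D →o (D →o D) from
    ⟨fun a => ⟨fun b => f a b, fun _ _ h => hf _ _ _ _ le_rfl h⟩,
      fun _ _ h b => hf _ _ b b h le_rfl⟩

/-- A ternary monotone operation as an element of the hierarchy. -/
def mono3 (D : PartOrd.{0}) (f : D → D → D → D)
    (hf : ∀ a a' b b' c c' : D, a ≤ a' → b ≤ b' → c ≤ c' → f a b c ≤ f a' b' c') :
    MonoCar D Ty.bool3 :=
  show D →o (D →o (D →o D)) from
    ⟨fun a => ⟨fun b => ⟨fun c => f a b c, fun _ _ h => hf _ _ _ _ _ _ le_rfl le_rfl h⟩,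
      fun _ _ h c => hf _ _ _ _ c c le_rfl h le_rfl⟩,
      fun _ _ h b c => hf _ _ b b c c h le_rfl le_rfl⟩

/-! ### Partial booleans -/

/-- The booleans with an undefined element. -/
inductive CBool : Type
  | bot | tt | ff
  deriving DecidableEq

instance : Fintype CBool where
  elems := {CBool.bot, CBool.tt, CBool.ff}
  complete := by intro x; cases x <;> simp

/-- The flat order `⊥ < tt, ff`. -/
instance : PartialOrder CBool where
  le a b := a = CBool.bot ∨ a = b
  le_refl _ := Or.inr rfl
  le_trans := by
    rintro a b c (rfl | rfl) h
    · exact Or.inl rfl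
    · exact h
  le_antisymm := by
    rintro a b (rfl | rfl) (h | h)
    · exact h.symm
    · exact h.symm
    · rfl
    · rfl

instance : DecidableRel (fun a b : CBool => a ≤ b) :=
  fun a b => inferInstanceAs (Decidable (a = CBool.bot ∨ a = b))

/-- The conditional on partial booleans. -/
def CBool.cond : CBool → CBool → CBool → CBool
  | CBool.bot, _, _ => CBool.bot
  | CBool.tt, e, _ => e
  | CBool.ff, _, f => f

/-- Parallel-or on partial booleans. -/
def CBool.por : CBool → CBool → CBool
  | CBool.tt, _ => CBool.tt
  | _, CBool.tt => CBool.tt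
  | CBool.ff, CBool.ff => CBool.ff
  | CBool.ff, CBool.bot => CBool.bot
  | CBool.bot, CBool.ff => CBool.bot
  | CBool.bot, CBool.bot => CBool.bot

theorem CBool.cond_mono : ∀ a a' b b' c c' : CBool, a ≤ a' → b ≤ b' → c ≤ c' →
    CBool.cond a b c ≤ CBool.cond a' b' c' := by decide

theorem CBool.por_mono : ∀ a a' b b' : CBool, a ≤ a' → b ≤ b' →
    CBool.por a b ≤ CBool.por a' b' := by decide

/-- The ground domain of `C`. -/
abbrev domC : PartOrd.{0} := PartOrd.of CBool

/-- Constants of the basic boolean calculus in `C`. -/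
def constCS : ∀ {σ : Ty}, ConstS σ → MonoCar domC σ
  | _, ConstS.true => CBool.tt
  | _, ConstS.false => CBool.ff
  | _, ConstS.cond => mono3 domC CBool.cond CBool.cond_mono

/-- Constants of the extended calculus in `C`. -/
def constCC : ∀ {σ : Ty}, ConstC σ → MonoCar domC σ
  | _, ConstC.ofS c => constCS c
  | _, ConstC.omega => CBool.bot
  | _, ConstC.por => mono2 domC CBool.por CBool.por_mono

theorem CBool.por_tt : ∀ a : CBool, CBool.por a CBool.tt = CBool.tt := by decide

/-- `C` as a model of the basic boolean calculus. -/
def modelCS : Model LambdaS := monoModel LambdaS domC constCS (by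
  intro Γ σ P Q h ρ
  cases h <;> rfl)

/-- `C` as a model of the extended calculus. -/
def modelCC : Model LambdaC := monoModel LambdaC domC constCC (by
  intro Γ σ P Q h ρ
  cases h
  case por_true_right => exact CBool.por_tt _
  all_goals rfl)

/-! ### Partial booleans with errors -/

/-- The booleans with an undefined element and an error. -/
inductive LBool : Type
  | bot | tt | ff | top
  deriving DecidableEq

instance : Fintype LBool where
  elems := {LBool.bot, LBool.tt, LBool.ff, LBool.top}
  complete := by intro x; cases x <;> simp

/-- The lattice order `⊥ < tt, ff < ⊤`. -/
instance : PartialOrder LBool where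
  le a b := a = LBool.bot ∨ b = LBool.top ∨ a = b
  le_refl _ := Or.inr (Or.inr rfl)
  le_trans := by decide
  le_antisymm := by decide

instance : DecidableRel (fun a b : LBool => a ≤ b) :=
  fun a b => inferInstanceAs (Decidable (a = LBool.bot ∨ b = LBool.top ∨ a = b))

/-- The conditional on partial booleans with errors. -/
def LBool.cond : LBool → LBool → LBool → LBool
  | LBool.bot, _, _ => LBool.bot
  | LBool.tt, e, _ => e
  | LBool.ff, _, f => f
  | LBool.top, _, _ => LBool.top

/-- Parallel-or on partial booleans with errors. -/
def LBool.por : LBool → LBool → LBool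
  | LBool.tt, _ => LBool.tt
  | _, LBool.tt => LBool.tt
  | LBool.bot, LBool.bot => LBool.bot
  | LBool.bot, LBool.ff => LBool.bot
  | LBool.bot, LBool.top => LBool.tt
  | LBool.ff, LBool.bot => LBool.bot
  | LBool.ff, LBool.ff => LBool.ff
  | LBool.ff, LBool.top => LBool.top
  | LBool.top, LBool.bot => LBool.tt
  | LBool.top, LBool.ff => LBool.top
  | LBool.top, LBool.top => LBool.top

theorem LBool.cond_mono : ∀ a a' b b' c c' : LBool, a ≤ a' → b ≤ b' → c ≤ c' →
    LBool.cond a b c ≤ LBool.cond a' b' c' := by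
  intro a a' b b' c c' ha hb hc
  rcases ha with rfl | rfl | rfl
  · exact Or.inl rfl
  · exact Or.inr (Or.inl rfl)
  · cases a
    · exact le_rfl
    · exact hb
    · exact hc
    · exact le_rfl

theorem LBool.por_mono : ∀ a a' b b' : LBool, a ≤ a' → b ≤ b' →
    LBool.por a b ≤ LBool.por a' b' := by decide

/-- The ground domain of `L`. -/
abbrev domL : PartOrd.{0} := PartOrd.of LBool

/-- Constants of the extended calculus in `L`. -/
def constLC : ∀ {σ : Ty}, ConstC σ → MonoCar domL σ
  | _, ConstC.ofS ConstS.true => LBool.tt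
  | _, ConstC.ofS ConstS.false => LBool.ff
  | _, ConstC.ofS ConstS.cond => mono3 domL LBool.cond LBool.cond_mono
  | _, ConstC.omega => LBool.bot
  | _, ConstC.por => mono2 domL LBool.por LBool.por_mono

theorem LBool.por_tt : ∀ a : LBool, LBool.por a LBool.tt = LBool.tt := by decide

/-- `L` as a model of the extended calculus. -/
def modelLC : Model LambdaC := monoModel LambdaC domL constLC (by
  intro Γ σ P Q h ρ
  cases h
  case por_true_right => exact LBool.por_tt _
  all_goals rfl)

/-! ### Example terms -/

/-- `λx. true`. -/
def constTrue : LambdaS.Closed (Ty.arrow Ty.bool Ty.bool) :=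
  Term.lam (Term.const ConstS.true)

/-- `λx. if x then true else true`. -/
def strictTrue : LambdaS.Closed (Ty.arrow Ty.bool Ty.bool) :=
  Term.lam (Term.app3 (K := ConstS) ConstS.cond (Term.var Var.zero) (Term.const ConstS.true)
    (Term.const ConstS.true))

/-- `λx. Ω`. -/
def constOmega : LambdaC.Closed (Ty.arrow Ty.bool Ty.bool) :=
  Term.lam (Term.const ConstC.omega)

/-- `λx. if x then Ω else Ω`. -/
def strictOmega : LambdaC.Closed (Ty.arrow Ty.bool Ty.bool) :=
  Term.lam (Term.app3 (K := ConstC) (ConstC.ofS ConstS.cond) (Term.var Var.zero)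
    (Term.const ConstC.omega) (Term.const ConstC.omega))

end ExtCollapse

namespace ExtCollapse

/-! Each inclusion comes from a logical relation between the two models. By `LogRel.interp` it
relates the two denotations of every closed term. If it reaches every element of the target at every
type, it is a partial function there (`LogRel.functional`), so equal denotations stay equal.
Surjectivity at `σ → τ` is the real work: a function on the target has to be represented by a
monotone function defined on all of the source, including elements related to nothing. From `C` onto
`S` the value is prescribed above represented elements and is bottom elsewhere; this is unambiguous
because represented elements with a common upper bound represent the same thing. From `L` onto `C`
the value is a supremum of prescribed values below; it is the right one at represented arguments
because the relation reflects the order. Consistency, respectively reflection and a monotone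
section, therefore join the induction on types. Applying the example terms to `⊥` in `C` and to `⊤`
in `L` makes the inclusions strict. -/

/-! ### Logical relations and inclusion of theories -/

/-- The logical relation between two type frames generated by a relation at ground type. -/
def LogRel (F G : TypeFrame) (r : F.carrier Ty.bool → G.carrier Ty.bool → Prop) :
    ∀ σ : Ty, F.carrier σ → G.carrier σ → Prop
  | Ty.bool => r
  | Ty.arrow σ τ => fun f g => ∀ x d, LogRel F G r σ x d → LogRel F G r τ (F.app f x) (G.app g d)

/-- The fundamental lemma of logical relations. -/
theorem LogRel.interp {Λ : Calculus} {M N : Model Λ}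
    {r : M.frame.carrier Ty.bool → N.frame.carrier Ty.bool → Prop}
    (hc : ∀ {σ : Ty} (c : Λ.Const σ), LogRel M.frame N.frame r σ (M.constInterp c)
      (N.constInterp c)) :
    ∀ {Γ : List Ty} {σ : Ty} (P : Λ.Tm Γ σ) (ρ : Env M.frame.carrier Γ)
      (ρ' : Env N.frame.carrier Γ), (∀ τ v, LogRel M.frame N.frame r τ (ρ τ v) (ρ' τ v)) →
      LogRel M.frame N.frame r σ (M.interp P ρ) (N.interp P ρ')
  | _, _, Term.var v, ρ, ρ', h => by
    rw [M.interp_var, N.interp_var]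
    exact h _ v
  | _, _, Term.const c, ρ, ρ', _ => by
    rw [M.interp_const, N.interp_const]
    exact hc c
  | _, _, Term.app P Q, ρ, ρ', h => by
    rw [M.interp_app, N.interp_app]
    exact LogRel.interp hc P ρ ρ' h _ _ (LogRel.interp hc Q ρ ρ' h)
  | _, _, Term.lam P, ρ, ρ', h => by
    intro x d hxd
    rw [M.interp_lam, N.interp_lam]
    refine LogRel.interp hc P _ _ fun τ v => ?_
    cases v with
    | zero => exact hxd
    | succ v => exact h _ v

/-- A surjective logical relation that is functional at ground type is functional. -/
theorem LogRel.functional {F G : TypeFrame} {r : F.carrier Ty.bool → G.carrier Ty.bool → Prop}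
    (hr : ∀ x a b, r x a → r x b → a = b) (hsurj : ∀ σ d, ∃ x, LogRel F G r σ x d) :
    ∀ (σ : Ty) (x : F.carrier σ) (a b : G.carrier σ),
      LogRel F G r σ x a → LogRel F G r σ x b → a = b
  | Ty.bool, x, a, b, ha, hb => hr x a b ha hb
  | Ty.arrow σ τ, f, a, b, ha, hb => G.ext a b fun d => by
    -- Relatedness of functions constrains the value at `d` only through some `x` that represents
    -- `d`.
    obtain ⟨x, hx⟩ := hsurj σ d
    exact LogRel.functional hr hsurj τ _ _ _ (ha x d hx) (hb x d hx)

/-- A model inherits the equations of any model that maps onto it by a logical relation. -/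
theorem Th_subset_of_logRel {Λ : Calculus} {M N : Model Λ}
    (r : M.frame.carrier Ty.bool → N.frame.carrier Ty.bool → Prop)
    (hc : ∀ {σ : Ty} (c : Λ.Const σ), LogRel M.frame N.frame r σ (M.constInterp c)
      (N.constInterp c))
    (hr : ∀ x a b, r x a → r x b → a = b)
    (hsurj : ∀ σ d, ∃ x, LogRel M.frame N.frame r σ x d) : Th M ⊆ Th N := by
  rintro ⟨σ, P, Q⟩ (h : M.eval P = M.eval Q)
  have key : ∀ P : Λ.Closed σ, LogRel M.frame N.frame r σ (M.eval P) (N.eval P) := fun P =>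
    LogRel.interp hc P _ _ fun _ v => nomatch v
  have hP := key P
  rw [h] at hP
  exact LogRel.functional hr hsurj σ _ _ _ hP (key Q)

/-! ### The full hierarchy as a quotient of the monotone one -/

/-- A partial boolean related to its boolean value. -/
def totalRel (x : CBool) (b : Bool) : Prop :=
  (x = CBool.tt ∧ b = true) ∨ (x = CBool.ff ∧ b = false)

/-- The monotone hierarchy over the partial booleans has least elements. -/
theorem exists_bot_C : ∀ τ : Ty, ∃ b : MonoCar domC τ, ∀ x, b ≤ x
  | Ty.bool => ⟨CBool.bot, fun _ => Or.inl rfl⟩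
  | Ty.arrow σ τ => by
    obtain ⟨b, hb⟩ := exists_bot_C τ
    exact ⟨(⟨fun _ => b, fun _ _ _ => le_rfl⟩ : MonoObj domC σ →o MonoObj domC τ),
      fun f x => hb _⟩

/-- In the flat order `tt` and `ff` have no common upper bound. -/
theorem totalRel_consistent {x y z : CBool} {a b : Bool} (hx : x ≤ z) (hy : y ≤ z)
    (ha : totalRel x a) (hb : totalRel y b) : a = b := by
  rcases ha with ⟨rfl, rfl⟩ | ⟨rfl, rfl⟩ <;> rcases hb with ⟨rfl, rfl⟩ | ⟨rfl, rfl⟩ <;>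
    cases z <;> revert hx hy <;> decide

/-- Monotone functionals represent all functionals, and consistent ones represent the same. -/
theorem totalRel_surjective_consistent : ∀ σ : Ty,
    (∀ d, ∃ x, LogRel (monoFrame domC) frameS totalRel σ x d) ∧
    ∀ (x y z : MonoCar domC σ) (a b : FullObj σ), x ≤ z → y ≤ z →
      LogRel (monoFrame domC) frameS totalRel σ x a →
      LogRel (monoFrame domC) frameS totalRel σ y b → a = b
  | Ty.bool => by
    refine ⟨fun d => ?_, fun x y z a b hx hy ha hb => totalRel_consistent hx hy ha hb⟩
    change ∃ x : CBool, totalRel x d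
    cases (d : Bool)
    · exact ⟨CBool.ff, Or.inr ⟨rfl, rfl⟩⟩
    · exact ⟨CBool.tt, Or.inl ⟨rfl, rfl⟩⟩
  | Ty.arrow σ τ => by
    classical
    obtain ⟨surjσ, consσ⟩ := totalRel_surjective_consistent σ
    obtain ⟨surjτ, consτ⟩ := totalRel_surjective_consistent τ
    obtain ⟨bot, hbot⟩ := exists_bot_C τ
    choose rep hrep using surjτ
    constructor
    · intro (f : FullObj σ → FullObj τ)
      let R : MonoCar domC σ → FullObj σ → Prop := LogRel (monoFrame domC) frameS totalRel σ
      -- The chosen `d` is unique by consistency at `σ`, and `rep` depends on `d` alone, not on the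
      -- witness `y`.
      let g : MonoCar domC σ → MonoCar domC τ := fun x =>
        if h : ∃ d, ∃ y, y ≤ x ∧ R y d then rep (f h.choose) else bot
      have hg : ∀ x y d, y ≤ x → R y d → g x = rep (f d) := by
        intro x y d hyx hyd
        have h : ∃ d, ∃ y, y ≤ x ∧ R y d := ⟨d, y, hyx, hyd⟩
        obtain ⟨y', hy', hR⟩ := h.choose_spec
        have e : h.choose = d := consσ _ _ _ _ _ hy' hyx hR hyd
        exact (dif_pos h).trans (congrArg (fun d => rep (f d)) e)
      have hmono : Monotone g := by
        intro x x' hxx'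
        -- A witness below `x` is also below `x'`, so the two values coincide; without one, the
        -- value is bottom.
        by_cases h : ∃ d, ∃ y, y ≤ x ∧ R y d
        · obtain ⟨d, y, hyx, hyd⟩ := h
          exact ((hg x y d hyx hyd).trans (hg x' y d (hyx.trans hxx') hyd).symm).le
        · have : g x = bot := dif_neg h
          rw [this]
          exact hbot _
      refine ⟨(⟨g, hmono⟩ : MonoObj domC σ →o MonoObj domC τ), fun x d hxd => ?_⟩
      change LogRel (monoFrame domC) frameS totalRel τ (g x) (f d)
      rw [hg x x d le_rfl hxd]
      exact hrep _
    · intro f g h a b hfh hgh ha hb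
      refine frameS.ext a b fun d => ?_
      obtain ⟨x, hx⟩ := surjσ d
      exact consτ _ _ _ _ _ (hfh x) (hgh x) (ha x d hx) (hb x d hx)

/-- For the conditional only the tests `tt` and `ff` matter, since `⊥` is related to nothing. -/
theorem totalRel_const : ∀ {σ : Ty} (c : ConstS σ),
    LogRel (monoFrame domC) frameS totalRel σ (constCS c) (constS c)
  | _, ConstS.true => Or.inl ⟨rfl, rfl⟩
  | _, ConstS.false => Or.inr ⟨rfl, rfl⟩
  | _, ConstS.cond => by
    rintro x d (⟨rfl, rfl⟩ | ⟨rfl, rfl⟩) y e hy z f hz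
    · exact hy
    · exact hz

theorem Th_modelCS_subset : Th modelCS ⊆ Th modelS :=
  Th_subset_of_logRel (M := modelCS) (N := modelS) totalRel totalRel_const
    (fun _ _ _ ha hb => totalRel_consistent le_rfl le_rfl ha hb)
    fun σ => (totalRel_surjective_consistent σ).1

/-! ### Partial booleans as a quotient of the partial booleans with errors -/

/-- The inclusion of the partial booleans into those with errors. -/
def CBool.toL : CBool → LBool
  | CBool.bot => LBool.bot
  | CBool.tt => LBool.tt
  | CBool.ff => LBool.ff

theorem CBool.toL_le_toL : ∀ a b : CBool, a.toL ≤ b.toL ↔ a ≤ b := by decide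

/-- An error-free partial boolean related to itself. -/
def errorFreeRel (x : LBool) (d : CBool) : Prop := x = d.toL

/-- The monotone hierarchy over the lattice of partial booleans with errors is complete. -/
theorem exists_isLUB_L : ∀ (τ : Ty) (s : Set (MonoCar domL τ)), ∃ u, IsLUB s u
  | Ty.bool, (s : Set LBool) => by
    change ∃ u : LBool, IsLUB s u
    -- If neither extreme is the supremum, some `x ∈ s` is not `⊥` and some bound `u` is not `⊤`;
    -- then `x = u`, so `u` lies below every bound.
    by_cases htop : ∃ u ∈ upperBounds s, u ≠ LBool.top
    · by_cases hbot : LBool.bot ∈ upperBounds s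
      · exact ⟨LBool.bot, hbot, fun _ _ => Or.inl rfl⟩
      · obtain ⟨u, hu, hut⟩ := htop
        refine ⟨u, hu, fun v hv => ?_⟩
        obtain ⟨x, hx, hxb⟩ : ∃ x ∈ s, ¬ x ≤ LBool.bot := by
          simpa [upperBounds] using hbot
        have hxu := hu hx
        have hxv := hv hx
        revert hut hxb hxu hxv
        cases x <;> cases u <;> cases v <;> decide
    · push Not at htop
      exact ⟨LBool.top, fun _ _ => Or.inr (Or.inl rfl), fun v hv => (htop v hv).ge⟩
  | Ty.arrow σ τ, s => by
    change ∃ u : MonoObj domL σ →o MonoObj domL τ, IsLUB (α := MonoObj domL σ →o MonoObj domL τ) s u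
    let S : Set (MonoObj domL σ →o MonoObj domL τ) := s
    choose u hu using fun x =>
      exists_isLUB_L τ ((fun f : MonoObj domL σ →o MonoObj domL τ => f x) '' S)
    refine ⟨⟨u, fun x y hxy => (hu x).2 ?_⟩, ?_, ?_⟩
    · rintro _ ⟨f, hf, rfl⟩
      exact (f.monotone hxy).trans ((hu y).1 ⟨f, hf, rfl⟩)
    · exact fun f hf x => (hu x).1 ⟨f, hf, rfl⟩
    · intro v hv x
      refine (hu x).2 ?_
      rintro _ ⟨f, hf, rfl⟩
      exact hv hf x

/-- The logical relation generated by the error-free elements has a monotone section, and it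
reflects the order. -/
theorem errorFreeRel_section_reflects : ∀ σ : Ty,
    (∃ r : MonoCar domC σ → MonoCar domL σ, Monotone r ∧
      ∀ d, LogRel (monoFrame domL) (monoFrame domC) errorFreeRel σ (r d) d) ∧
    ∀ (x y : MonoCar domL σ) (d e : MonoCar domC σ), x ≤ y →
      LogRel (monoFrame domL) (monoFrame domC) errorFreeRel σ x d →
      LogRel (monoFrame domL) (monoFrame domC) errorFreeRel σ y e → d ≤ e
  | Ty.bool => by
    refine ⟨⟨CBool.toL, fun a b h => (CBool.toL_le_toL a b).2 h, fun _ => rfl⟩, ?_⟩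
    intro x y d e hxy hx hy
    rw [show x = CBool.toL d from hx, show y = CBool.toL e from hy] at hxy
    exact (CBool.toL_le_toL d e).1 hxy
  | Ty.arrow σ τ => by
    obtain ⟨⟨rσ, -, hrσ⟩, leσ⟩ := errorFreeRel_section_reflects σ
    obtain ⟨⟨rτ, monoτ, hrτ⟩, leτ⟩ := errorFreeRel_section_reflects τ
    constructor
    · let R : MonoCar domL σ → MonoCar domC σ → Prop :=
        LogRel (monoFrame domL) (monoFrame domC) errorFreeRel σ
      -- Prescribed values below `x` may conflict, as those at `tt` and `ff` do below `⊤`; the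
      -- suprema of `L` absorb such conflicts.
      let vals (f : MonoObj domC σ →o MonoObj domC τ) (x : MonoCar domL σ) :
          Set (MonoCar domL τ) := {z | ∃ y e, y ≤ x ∧ R y e ∧ z = rτ (f e)}
      choose g hg using fun f x => exists_isLUB_L τ (vals f x)
      have hmono : ∀ f, Monotone (g f) := fun f x x' h => (hg f x).2 (by
        rintro _ ⟨y, e, hy, hR, rfl⟩
        exact (hg f x').1 ⟨y, e, hy.trans h, hR, rfl⟩)
      refine ⟨fun f => (⟨g f, hmono f⟩ : MonoObj domL σ →o MonoObj domL τ), ?_, ?_⟩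
      · intro f f' hff' x
        refine (hg f x).2 ?_
        rintro _ ⟨y, e, hy, hR, rfl⟩
        exact (monoτ (hff' e)).trans ((hg f' x).1 ⟨y, e, hy, hR, rfl⟩)
      · intro (f : MonoObj domC σ →o MonoObj domC τ) x d hxd
        change LogRel (monoFrame domL) (monoFrame domC) errorFreeRel τ (g f x) (f d)
        -- At a represented `x` the supremum is attained: reflection turns `y ≤ x` into `e ≤ d`, and
        -- `f` and `rτ` are monotone.
        have hlub : IsLUB (vals f x) (rτ (f d)) := by
          refine ⟨?_, fun v hv => hv ⟨x, d, le_rfl, hxd, rfl⟩⟩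
          rintro _ ⟨y, e, hy, hR, rfl⟩
          exact monoτ (f.monotone (leσ y x e d hy hR hxd))
        rw [(hg f x).unique hlub]
        exact hrτ _
    · intro f g a b hfg ha hb d
      exact leτ _ _ _ _ (hfg (rσ d)) (ha _ d (hrσ d)) (hb _ d (hrσ d))

theorem CBool.toL_cond : ∀ a b c : CBool,
    LBool.cond a.toL b.toL c.toL = (CBool.cond a b c).toL := by decide

theorem CBool.toL_por : ∀ a b : CBool, LBool.por a.toL b.toL = (CBool.por a b).toL := by decide

/-- The ground relation is the graph of `CBool.toL`, which commutes with both operations; `⊤` never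
enters. -/
theorem errorFreeRel_const : ∀ {σ : Ty} (c : ConstC σ),
    LogRel (monoFrame domL) (monoFrame domC) errorFreeRel σ (constLC c) (constCC c)
  | _, ConstC.ofS ConstS.true => rfl
  | _, ConstC.ofS ConstS.false => rfl
  | _, ConstC.omega => rfl
  | _, ConstC.ofS ConstS.cond => by
    rintro _ d rfl _ e rfl _ f rfl
    exact CBool.toL_cond d e f
  | _, ConstC.por => by
    rintro _ d rfl _ e rfl
    exact CBool.toL_por d e

theorem Th_modelLC_subset : Th modelLC ⊆ Th modelCC := by
  refine Th_subset_of_logRel (M := modelLC) (N := modelCC) errorFreeRel errorFreeRel_const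
    (fun x a b ha hb => ?_) fun σ d => ?_
  -- Reflecting `x ≤ x` in both directions gives functionality.
  · exact le_antisymm (α := CBool) ((errorFreeRel_section_reflects Ty.bool).2 x x a b le_rfl ha hb)
      ((errorFreeRel_section_reflects Ty.bool).2 x x b a le_rfl hb ha)
  · obtain ⟨⟨r, -, hr⟩, -⟩ := errorFreeRel_section_reflects σ
    exact ⟨r d, hr d⟩

/-! ### Separating equations -/

/-- The conditional is strict in its test, which shows at `⊥` but at neither boolean. -/
theorem constTrue_eq_strictTrue_mem :
    Equation.mk constTrue strictTrue ∈ Th modelS \ Th modelCS := by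
  constructor
  · change modelS.eval constTrue = modelS.eval strictTrue
    refine modelS.frame.ext _ _ fun d => ?_
    cases (d : Bool) <;> rfl
  · intro h
    have h' := congrArg (fun f => modelCS.frame.app (σ := Ty.bool) (τ := Ty.bool) f CBool.bot)
      (show modelCS.eval constTrue = modelCS.eval strictTrue from h)
    exact CBool.noConfusion (show CBool.tt = CBool.bot from h')

/-- With both branches `⊥`, only the test `⊤` gives a value other than `⊥`. -/
theorem constOmega_eq_strictOmega_mem :
    Equation.mk constOmega strictOmega ∈ Th modelCC \ Th modelLC := by
  constructor
  · change modelCC.eval constOmega = modelCC.eval strictOmega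
    refine modelCC.frame.ext _ _ fun d => ?_
    cases (d : CBool) <;> rfl
  · intro h
    have h' := congrArg (fun f => modelLC.frame.app (σ := Ty.bool) (τ := Ty.bool) f LBool.top)
      (show modelLC.eval constOmega = modelLC.eval strictOmega from h)
    exact LBool.noConfusion (show LBool.bot = LBool.top from h')

end ExtCollapse

theorem mainTheorem6 :
    (ExtCollapse.Th ExtCollapse.modelCS ⊂ ExtCollapse.Th ExtCollapse.modelS ∧
      ExtCollapse.Th ExtCollapse.modelLC ⊂ ExtCollapse.Th ExtCollapse.modelCC) ∧
    (ExtCollapse.Equation.mk ExtCollapse.constTrue ExtCollapse.strictTrue ∈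
        ExtCollapse.Th ExtCollapse.modelS \ ExtCollapse.Th ExtCollapse.modelCS ∧
      ExtCollapse.Equation.mk ExtCollapse.constOmega ExtCollapse.strictOmega ∈
        ExtCollapse.Th ExtCollapse.modelCC \ ExtCollapse.Th ExtCollapse.modelLC) := by
  have hS := ExtCollapse.constTrue_eq_strictTrue_mem
  have hC := ExtCollapse.constOmega_eq_strictOmega_mem
  exact ⟨⟨⟨ExtCollapse.Th_modelCS_subset, fun h => hS.2 (h hS.1)⟩,
    ⟨ExtCollapse.Th_modelLC_subset, fun h => hC.2 (h hC.1)⟩⟩, hS, hC⟩
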